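/- Let $\lambda_G>0$, $a>0$, $P_x>0$, $\eta>0$, $\alpha>2$, and put $\delta=2/\alpha\in(0,1)$. Consider a Matérn cluster network in the plane seen from a typical receiver $y_0$ located at the origin: the other receivers $\Phi_G\setminus\{y_0\}$ form a homogeneous Poisson point process of density $\lambda_G$ on $\mathbb{R}^2$; each receiver $y$ serves a set $N_y$ of active nodes, whose positions relative to $y$ are uniformly distributed on the disc of radius $a$ centred at the origin; the power fading coefficient $h_{x,y}$ from each node to the typical receiver is exponentially distributed with unit mean. The receiver locations, the numbers of nodes, the relative node positions and the fading coefficients are all mutually independent. The inter-cluster interference at the typical receiver is $$I_{\mathrm{inter}}=\sum_{y\in\Phi_G\setminus\{y_0\}}\ \sum_{x\in N_y}P_x\,h_{x,y}\,\eta\,\|y+x\|^{-\alpha},$$ where $P_x$ is the common transmit power, and its Laplace transform is $\mathcal L_{I_{\mathrm{inter}}}(s)=\mathbb E\big[e^{-sI_{\mathrm{inter}}}\big]$. Let $s\ge 0$. (i) If every cluster has a fixed number $n$ of active nodes ($n$ a non-negative integer), then $$\mathcal L_{I_{\mathrm{inter}}}(s)\le\exp\Big(-\pi\lambda_G(sP_x\eta)^{\delta}\,\delta\sum_{p=1}^{n}\binom{n}{p}B(p-\delta,\,n-p+\delta)\Big),$$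 where $B(x,y)=\int_0^\infty\frac{t^{x-1}}{(1+t)^{x+y}}\,dt$ for $x,y>0$. (ii) If the numbers of active nodes in the clusters are independent and Poisson distributed with mean $\bar n\ge 0$, then $$\mathcal L_{I_{\mathrm{inter}}}(s)\ge\exp\Big(-\pi^2\lambda_G\,\bar n\,(sP_x\eta)^{\delta}\,\frac{\delta}{\sin(\pi\delta)}\Big).$$ -/

import Mathlib

open MeasureTheory ProbabilityTheory Set
open scoped ENNReal NNReal

noncomputable section

/-- The Euclidean plane. -/
abbrev Plane : Type := EuclideanSpace ℝ (Fin 2)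

/-- The number of points of the sequence `Y` that lie in `B`, counted with multiplicity. -/
def pointCount {Ω : Type*} (Y : ℕ → Ω → Plane) (B : Set Plane) (ω : Ω) : ℕ∞ :=
  {k : ℕ | Y k ω ∈ B}.encard

/-- `Y` enumerates the points of a homogeneous Poisson point process of density `lam` in the
plane: the number of points in a Borel set `B` of finite area is Poisson distributed with mean
`lam * area B`, and the numbers of points in pairwise disjoint sets are independent. -/
structure IsPoissonProcess {Ω : Type*} [MeasurableSpace Ω] (μ : Measure Ω) (lam : ℝ)
    (Y : ℕ → Ω → Plane) : Prop where
  measurable : ∀ k, Measurable (Y k)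
  law_count : ∀ B : Set Plane, MeasurableSet B → volume B ≠ ∞ →
    μ.map (pointCount Y B) =
      (poissonMeasure (ENNReal.ofReal lam * volume B).toNNReal).map (fun m : ℕ => (m : ℕ∞))
  indep_count : ∀ (m : ℕ) (B : Fin m → Set Plane), (∀ i, MeasurableSet (B i)) →
    (∀ i, volume (B i) ≠ ∞) → Pairwise (fun i j => Disjoint (B i) (B j)) →
    iIndepFun (fun i => pointCount Y (B i)) μ

/-- The clusters of a Matern cluster process seen from a typical receiver at the origin.
* `Y k` are the other receivers; they form a Poisson process of density `lam`.
* `N k` is the number of active nodes served by `Y k`, with law `ν`.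
* `X k i` is the position of the `i`-th node of the cluster relative to `Y k`, uniform on the
  disc of radius `a`; only the nodes with `i < N k` are active.
* `H k i` is the power fading coefficient, exponential with unit mean, between that node and the
  typical receiver.
All these variables are independent. -/
structure IsMaternNetwork {Ω : Type*} [MeasurableSpace Ω] (μ : Measure Ω) (lam a : ℝ)
    (ν : Measure ℕ) (Y : ℕ → Ω → Plane) (N : ℕ → Ω → ℕ) (X : ℕ → ℕ → Ω → Plane)
    (H : ℕ → ℕ → Ω → ℝ) : Prop where
  poisson : IsPoissonProcess μ lam Y
  measurable_size : ∀ k, Measurable (N k)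
  measurable_node : ∀ k i, Measurable (X k i)
  measurable_fading : ∀ k i, Measurable (H k i)
  law_size : ∀ k, μ.map (N k) = ν
  law_node : ∀ k i, pdf.IsUniform (X k i) (Metric.closedBall 0 a) μ volume
  law_fading : ∀ k i, μ.map (H k i) = expMeasure 1
  indep_size : iIndepFun N μ
  indep_node : iIndepFun (fun p : ℕ × ℕ => X p.1 p.2) μ
  indep_fading : iIndepFun (fun p : ℕ × ℕ => H p.1 p.2) μ
  indep_node_fading : IndepFun (fun ω (p : ℕ × ℕ) => X p.1 p.2 ω)
    (fun ω (p : ℕ × ℕ) => H p.1 p.2 ω) μ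
  indep_size_rest : IndepFun (fun ω k => N k ω)
    (fun ω => ((fun p : ℕ × ℕ => X p.1 p.2 ω), (fun p : ℕ × ℕ => H p.1 p.2 ω))) μ
  indep_receiver_rest : IndepFun (fun ω k => Y k ω)
    (fun ω => ((fun k => N k ω),
      ((fun p : ℕ × ℕ => X p.1 p.2 ω), (fun p : ℕ × ℕ => H p.1 p.2 ω)))) μ

/-- The inter-cluster interference `∑_y ∑_x P h η ‖y + x‖ ^ (-α)` at the typical receiver at the
origin; the sum is over all nodes of all other clusters and takes values in `[0, ∞]`. -/
def interClusterInterference {Ω : Type*} (P η α : ℝ) (Y : ℕ → Ω → Plane) (N : ℕ → Ω → ℕ)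
    (X : ℕ → ℕ → Ω → Plane) (H : ℕ → ℕ → Ω → ℝ) (ω : Ω) : ℝ≥0∞ :=
  ∑' k, ∑ i ∈ Finset.range (N k ω),
    ENNReal.ofReal (P * H k i ω * η) * ‖Y k ω + X k i ω‖ₑ ^ (-α)

/-- `exp (-x)` for `x` in `[0, ∞]`, with `exp (-∞) = 0`. -/
def expNeg (x : ℝ≥0∞) : ℝ := if x = ∞ then 0 else Real.exp (-x.toReal)

/-- The Laplace transform `s ↦ E[exp (-s I)]` of a `[0, ∞]`-valued random variable `I`. -/
def laplaceTransform {Ω : Type*} [MeasurableSpace Ω] (μ : Measure Ω) (I : Ω → ℝ≥0∞) (s : ℝ) : ℝ :=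
  ∫ ω, expNeg (ENNReal.ofReal s * I ω) ∂μ

/-- The Beta function `B(x, y) = ∫_0^∞ t ^ (x - 1) / (1 + t) ^ (x + y) dt` for `x, y > 0`. -/
def betaFun (x y : ℝ) : ℝ := ∫ t in Ioi (0 : ℝ), t ^ (x - 1) / (1 + t) ^ (x + y)

end

/-! Condition on everything but the fading, then on everything but the node positions, then on the
cluster sizes. Given the receivers, the clusters factorise. With `u z` the Laplace transform of the
power received from a node at `z` (`nodeFactor`), `v y` the mean of `u (y + x)` over the disc
(`clusterNodeFactor`), and `G` the generating function of the cluster size, the Laplace functional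
of the Poisson process gives `E[exp (-s I)] = exp (-lam * ∫ (1 - G (v y)) dy)`
(`IsMaternNetwork.laplaceTransform_eq`).

The two bounds compare this exponent with an integral of `u` alone. For `n` nodes, Jensen gives `v ^
n ≤` the disc average of `u ^ n`. For Poisson sizes, `1 - exp (-nbar * (1 - v)) ≤ nbar * (1 - v)`.
In both cases the disc average then disappears, because Lebesgue measure is translation invariant
(`lintegral_lintegral_add_cond`); this is why `a` is absent from the bounds.

Exponential fading gives `u z = 1 / (1 + s P η ‖z‖ ^ (-α))`. Polar coordinates turn `∫ (1 - u ^ n)`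
into a one-dimensional integral, and the binomial expansion splits it into Beta integrals. The
Poisson bound is the case `n = 1`, evaluated by the reflection formula. -/

noncomputable section

open Filter Topology

/-! ### Laplace transforms of `[0, ∞]`-valued variables -/

/-- The function `x ↦ exp (-x)` from `[0, ∞]` to `[0, 1]`. -/
def ennrealExpNeg (x : ℝ≥0∞) : ℝ≥0∞ := EReal.exp (-(x : EReal))

/-- A right inverse of `ennrealExpNeg` on `[0, 1]`, namely `x ↦ -log x`. -/
def ennrealNegLog (x : ℝ≥0∞) : ℝ≥0∞ := (-(ENNReal.log x)).toENNReal

namespace ennrealExpNeg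

lemma eq_inv (x : ℝ≥0∞) : ennrealExpNeg x = (EReal.exp (x : EReal))⁻¹ :=
  EReal.exp_neg _

@[simp] lemma zero : ennrealExpNeg 0 = 1 := by simp [ennrealExpNeg]

@[simp] lemma top : ennrealExpNeg ∞ = 0 := by simp [ennrealExpNeg]

lemma coe (x : ℝ≥0) : ennrealExpNeg x = ENNReal.ofReal (Real.exp (-x)) := by
  have : ((x : ℝ≥0∞) : EReal) = ((x : ℝ) : EReal) := rfl
  rw [ennrealExpNeg, this, ← EReal.coe_neg, EReal.exp_coe]

lemma ofReal {x : ℝ} (hx : 0 ≤ x) :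
    ennrealExpNeg (ENNReal.ofReal x) = ENNReal.ofReal (Real.exp (-x)) := by
  lift x to ℝ≥0 using hx
  rw [ENNReal.ofReal_coe_nnreal, coe]

lemma continuous : Continuous ennrealExpNeg :=
  ENNReal.continuous_exp.comp (continuous_neg.comp continuous_coe_ennreal_ereal)

lemma measurable : Measurable ennrealExpNeg := continuous.measurable

lemma antitone : Antitone ennrealExpNeg := fun x y h => by
  rw [eq_inv, eq_inv]
  exact ENNReal.inv_le_inv.2 (EReal.exp_monotone (by exact_mod_cast h))

lemma le_one (x : ℝ≥0∞) : ennrealExpNeg x ≤ 1 := by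
  simpa using antitone (zero_le (a := x))

lemma ne_top (x : ℝ≥0∞) : ennrealExpNeg x ≠ ∞ :=
  ((le_one x).trans_lt ENNReal.one_lt_top).ne

lemma add (x y : ℝ≥0∞) : ennrealExpNeg (x + y) = ennrealExpNeg x * ennrealExpNeg y := by
  induction x with
  | top => simp
  | coe x =>
    induction y with
    | top => simp
    | coe y =>
      rw [← ENNReal.coe_add, coe, coe, coe, ← ENNReal.ofReal_mul (Real.exp_nonneg _),
        ← Real.exp_add]
      congr 2
      push_cast
      ring

lemma sum {ι : Type*} (s : Finset ι) (f : ι → ℝ≥0∞) :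
    ennrealExpNeg (∑ i ∈ s, f i) = ∏ i ∈ s, ennrealExpNeg (f i) := by
  classical
  induction s using Finset.induction_on with
  | empty => simp
  | insert a s ha ih => rw [Finset.sum_insert ha, Finset.prod_insert ha, add, ih]

lemma nat_mul (n : ℕ) (x : ℝ≥0∞) : ennrealExpNeg (n * x) = ennrealExpNeg x ^ n := by
  simpa using sum (Finset.range n) (fun _ => x)

/-- Allows an infinite product of factors in `[0, 1]` to be written as `ennrealExpNeg` of a series,
which always converges in `[0, ∞]`; the factor `0` corresponds to the term `∞`. -/
lemma negLog {x : ℝ≥0∞} (hx : x ≤ 1) : ennrealExpNeg (ennrealNegLog x) = x := by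
  have h : 0 ≤ -(ENNReal.log x) := by
    rw [EReal.le_neg, neg_zero]
    exact ENNReal.log_le_zero_iff.2 hx
  rw [ennrealExpNeg, ennrealNegLog, EReal.coe_toENNReal h, neg_neg, ENNReal.exp_log]

lemma tendsto_prod {ι : Type*} (f : ι → ℝ≥0∞) :
    Tendsto (fun s : Finset ι => ∏ i ∈ s, ennrealExpNeg (f i)) atTop
      (𝓝 (ennrealExpNeg (∑' i, f i))) := by
  simp_rw [← sum]
  exact (continuous.tendsto _).comp ENNReal.summable.hasSum

lemma eq_ofReal_expNeg (x : ℝ≥0∞) : ennrealExpNeg x = ENNReal.ofReal (expNeg x) := by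
  induction x with
  | top => simp [expNeg]
  | coe x => simp [expNeg, coe]

end ennrealExpNeg

lemma measurable_ennrealNegLog : Measurable ennrealNegLog := by
  unfold ennrealNegLog
  exact (ENNReal.measurable_log.neg).ereal_toENNReal

lemma expNeg_nonneg (x : ℝ≥0∞) : 0 ≤ expNeg x := by
  unfold expNeg
  split_ifs <;> positivity

lemma laplaceTransform_eq_toReal_lintegral {Ω : Type*} [MeasurableSpace Ω] (μ : Measure Ω)
    {I : Ω → ℝ≥0∞} (hI : Measurable I) (s : ℝ) :
    laplaceTransform μ I s = (∫⁻ ω, ennrealExpNeg (ENNReal.ofReal s * I ω) ∂μ).toReal := by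
  have h : (fun ω => expNeg (ENNReal.ofReal s * I ω)) =
      fun ω => (ennrealExpNeg (ENNReal.ofReal s * I ω)).toReal := by
    funext ω
    rw [ennrealExpNeg.eq_ofReal_expNeg, ENNReal.toReal_ofReal (expNeg_nonneg _)]
  rw [laplaceTransform, h]
  exact integral_toReal (ennrealExpNeg.measurable.comp (hI.const_mul _)).aemeasurable
    (Eventually.of_forall fun ω => (ennrealExpNeg.ne_top _).lt_top)

/-- The expectation of `exp (-∑ f i (Z i))` for independent `Z i` factorises. -/
lemma lintegral_ennrealExpNeg_tsum {Ω ι : Type*} {E : ι → Type*} [Countable ι]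
    [MeasurableSpace Ω] [∀ i, MeasurableSpace (E i)] {μ : Measure Ω} [IsProbabilityMeasure μ]
    {Z : ∀ i, Ω → E i} (hZ : iIndepFun Z μ) (hZm : ∀ i, Measurable (Z i))
    {f : ∀ i, E i → ℝ≥0∞} (hf : ∀ i, Measurable (f i)) :
    ∫⁻ ω, ennrealExpNeg (∑' i, f i (Z i ω)) ∂μ =
      ennrealExpNeg (∑' i, ennrealNegLog (∫⁻ ω, ennrealExpNeg (f i (Z i ω)) ∂μ)) := by
  have hm : ∀ i, Measurable fun ω => ennrealExpNeg (f i (Z i ω)) := fun i =>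
    ennrealExpNeg.measurable.comp ((hf i).comp (hZm i))
  have hle : ∀ i, ∫⁻ ω, ennrealExpNeg (f i (Z i ω)) ∂μ ≤ 1 := fun i =>
    (lintegral_mono fun ω => ennrealExpNeg.le_one _).trans (by simp)
  have h1 : Tendsto (fun s : Finset ι => ∫⁻ ω, ∏ i ∈ s, ennrealExpNeg (f i (Z i ω)) ∂μ) atTop
      (𝓝 (∫⁻ ω, ennrealExpNeg (∑' i, f i (Z i ω)) ∂μ)) := by
    -- Countability of `ι` makes the filter of finite subsets countably generated, as dominated
    -- convergence requires.
    refine tendsto_lintegral_filter_of_dominated_convergence (fun _ => 1) ?_ ?_ (by simp) ?_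
    · exact Eventually.of_forall fun s => Finset.measurable_prod s fun i _ => hm i
    · exact Eventually.of_forall fun s => Eventually.of_forall fun ω =>
        Finset.prod_le_one' fun i _ => ennrealExpNeg.le_one _
    · exact Eventually.of_forall fun ω => ennrealExpNeg.tendsto_prod _
  have h2 := ennrealExpNeg.tendsto_prod
    fun i => ennrealNegLog (∫⁻ ω, ennrealExpNeg (f i (Z i ω)) ∂μ)
  refine tendsto_nhds_unique h1 (h2.congr fun s => ?_)
  rw [lintegral_prod_eq_prod_lintegral_of_indepFun s
    (fun i ω => ennrealExpNeg (f i (Z i ω)))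
    (hZ.comp (fun i x => ennrealExpNeg (f i x)) fun i => ennrealExpNeg.measurable.comp (hf i)) hm]
  exact Finset.prod_congr rfl fun i _ => ennrealExpNeg.negLog (hle i)

/-! ### The Laplace functional of a Poisson process -/

/-- The probability generating function of the Poisson distribution. -/
lemma lintegral_pow_poissonMeasure (r : ℝ≥0) {x : ℝ≥0∞} (hx : x ≤ 1) :
    ∫⁻ m, x ^ m ∂(poissonMeasure r) = ennrealExpNeg (r * (1 - x)) := by
  lift x to ℝ≥0 using (hx.trans_lt ENNReal.one_lt_top).ne
  have hx' : x ≤ 1 := by exact_mod_cast hx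
  rw [poissonMeasure, lintegral_sum_measure]
  simp only [lintegral_smul_measure, lintegral_dirac, smul_eq_mul]
  have hsum : HasSum (fun m : ℕ => Real.exp (-r) * r ^ m / m.factorial * (x : ℝ) ^ m)
      (Real.exp (-r) * Real.exp (r * x)) := by
    have h := (NormedSpace.expSeries_div_hasSum_exp ((r : ℝ) * x)).mul_left (Real.exp (-r))
    rw [← Real.exp_eq_exp_ℝ] at h
    have he : (fun m : ℕ => Real.exp (-r) * r ^ m / m.factorial * (x : ℝ) ^ m) =
        fun m : ℕ => Real.exp (-r) * (((r : ℝ) * x) ^ m / m.factorial) := by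
      funext m
      rw [mul_pow]
      ring
    rw [he]
    exact h
  have hterm : ∀ m : ℕ, ENNReal.ofReal (Real.exp (-r) * r ^ m / m.factorial) * (x : ℝ≥0∞) ^ m =
      ENNReal.ofReal (Real.exp (-r) * r ^ m / m.factorial * (x : ℝ) ^ m) := fun m => by
    rw [ENNReal.ofReal_mul (by positivity), ENNReal.ofReal_pow (NNReal.coe_nonneg x), ENNReal.ofReal_coe_nnreal]
  simp_rw [hterm]
  rw [← ENNReal.ofReal_tsum_of_nonneg (fun m => by positivity) hsum.summable, hsum.tsum_eq,
    ← Real.exp_add]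
  have : (r : ℝ≥0∞) * (1 - x) = ((r * (1 - x) : ℝ≥0) : ℝ≥0∞) := by push_cast; rfl
  rw [this, ennrealExpNeg.coe]
  congr 2
  rw [NNReal.coe_mul, NNReal.coe_sub hx']
  push_cast
  ring

lemma pointCount_eq_tsum {Ω : Type*} (Y : ℕ → Ω → Plane) (B : Set Plane) (ω : Ω) :
    ((pointCount Y B ω : ℕ∞) : ℝ≥0∞) = ∑' k, B.indicator (fun _ => 1) (Y k ω) := by
  rw [pointCount, ← ENNReal.tsum_set_one, tsum_subtype {k | Y k ω ∈ B} (fun _ => (1 : ℝ≥0∞))]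
  rfl

section PoissonProcess

variable {Ω : Type*} [MeasurableSpace Ω] {μ : Measure Ω} {lam : ℝ} {Y : ℕ → Ω → Plane}

lemma measurable_pointCount (hY : ∀ k, Measurable (Y k)) {B : Set Plane} (hB : MeasurableSet B) :
    Measurable (pointCount Y B) := by
  refine measurable_encard.comp (measurable_set_iff.2 fun k => ?_)
  exact measurableSet_setOfPred.1 (hY k hB)

lemma IsPoissonProcess.indep_count_fintype (h : IsPoissonProcess μ lam Y) {ι : Type*} [Fintype ι]
    {B : ι → Set Plane} (hB : ∀ i, MeasurableSet (B i)) (hB' : ∀ i, volume (B i) ≠ ∞)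
    (hd : Pairwise fun i j => Disjoint (B i) (B j)) :
    iIndepFun (fun i => pointCount Y (B i)) μ := by
  have e := Fintype.equivFin ι
  have := h.indep_count _ (fun i => B (e.symm i)) (fun i => hB _) (fun i => hB' _)
    (fun i j hij => hd (e.symm.injective.ne hij))
  simpa using this.precomp e.injective

lemma IsPoissonProcess.lintegral_pointCount (h : IsPoissonProcess μ lam Y) {B : Set Plane}
    (hB : MeasurableSet B) (hB' : volume B ≠ ∞) (c : ℝ≥0∞) :
    ∫⁻ ω, ennrealExpNeg (c * ((pointCount Y B ω : ℕ∞) : ℝ≥0∞)) ∂μ =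
      ennrealExpNeg (ENNReal.ofReal lam * (volume B * (1 - ennrealExpNeg c))) := by
  have h1 : ∫⁻ ω, ennrealExpNeg (c * ((pointCount Y B ω : ℕ∞) : ℝ≥0∞)) ∂μ =
      ∫⁻ m, ennrealExpNeg (c * ((m : ℕ∞) : ℝ≥0∞)) ∂(μ.map (pointCount Y B)) :=
    (lintegral_map (f := fun m : ℕ∞ => ennrealExpNeg (c * (m : ℝ≥0∞))) .of_discrete
      (measurable_pointCount h.measurable hB)).symm
  rw [h1, h.law_count B hB hB', lintegral_map .of_discrete .of_discrete]
  have h2 : ∀ m : ℕ, ennrealExpNeg (c * (((m : ℕ∞)) : ℝ≥0∞)) = ennrealExpNeg c ^ m := fun m => by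
    rw [← ennrealExpNeg.nat_mul, mul_comm]
    simp
  simp_rw [h2]
  rw [lintegral_pow_poissonMeasure _ (ennrealExpNeg.le_one c), ENNReal.coe_toNNReal, mul_assoc]
  exact ENNReal.mul_ne_top ENNReal.ofReal_ne_top hB'

/-- The Laplace functional of a Poisson process at a finite combination of indicators. -/
lemma IsPoissonProcess.lintegral_sum_pointCount (h : IsPoissonProcess μ lam Y) {ι : Type*}
    [Fintype ι] {B : ι → Set Plane} (hB : ∀ i, MeasurableSet (B i)) (hB' : ∀ i, volume (B i) ≠ ∞)
    (hd : Pairwise fun i j => Disjoint (B i) (B j)) (c : ι → ℝ≥0∞) :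
    ∫⁻ ω, ennrealExpNeg (∑ i, c i * ((pointCount Y (B i) ω : ℕ∞) : ℝ≥0∞)) ∂μ =
      ennrealExpNeg (ENNReal.ofReal lam * ∑ i, volume (B i) * (1 - ennrealExpNeg (c i))) := by
  have hm : ∀ i, Measurable fun m : ℕ∞ => ennrealExpNeg (c i * (m : ℝ≥0∞)) := fun i => .of_discrete
  simp_rw [ennrealExpNeg.sum, Finset.mul_sum]
  rw [lintegral_prod_eq_prod_lintegral_of_indepFun Finset.univ
    (fun i ω => ennrealExpNeg (c i * ((pointCount Y (B i) ω : ℕ∞) : ℝ≥0∞)))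
    ((h.indep_count_fintype hB hB' hd).comp _ hm)
    (fun i => (hm i).comp (measurable_pointCount h.measurable (hB i))), ennrealExpNeg.sum]
  exact Finset.prod_congr rfl fun i _ => h.lintegral_pointCount (hB i) (hB' i) (c i)

/-- The value `0` is left out because its fibre may have infinite area, where the law of the point
count is not prescribed. -/
lemma sum_indicator_fiber (f : SimpleFunc Plane ℝ≥0∞) (g : ℝ≥0∞ → ℝ≥0∞) (hg : g 0 = 0)
    (y : Plane) : g (f y) =
      ∑ v : (f.range.erase 0), g v * (f ⁻¹' {(v : ℝ≥0∞)}).indicator (fun _ => 1) y := by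
  classical
  rw [Finset.sum_coe_sort (f.range.erase 0)
    (fun v => g v * (f ⁻¹' {v}).indicator (fun _ => 1) y)]
  have : ∀ v ∈ f.range.erase 0, g v * (f ⁻¹' {v}).indicator (fun _ => 1) y =
      if v = f y then g v else 0 := fun v _ => by
    by_cases hv : v = f y
    · simp [hv]
    · simp [indicator, hv, Ne.symm hv]
  rw [Finset.sum_congr rfl this, Finset.sum_ite_eq']
  split_ifs with h0
  · rfl
  · have : f y = 0 := by
      by_contra hne
      exact h0 (Finset.mem_erase.2 ⟨hne, f.mem_range_self y⟩)
    rw [this, hg]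

/-- The sum over the points is a finite combination of counts in the disjoint level sets of `f`,
which are independent Poisson variables. -/
lemma IsPoissonProcess.laplace_functional_simpleFunc (h : IsPoissonProcess μ lam Y)
    (f : SimpleFunc Plane ℝ≥0∞) (hf : volume (Function.support f) ≠ ∞) :
    ∫⁻ ω, ennrealExpNeg (∑' k, f (Y k ω)) ∂μ =
      ennrealExpNeg (ENNReal.ofReal lam * ∫⁻ y, (1 - ennrealExpNeg (f y))) := by
  have hB : ∀ v : (f.range.erase 0), MeasurableSet (f ⁻¹' {(v : ℝ≥0∞)}) :=
    fun v => f.measurableSet_preimage _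
  have hB' : ∀ v : (f.range.erase 0), volume (f ⁻¹' {(v : ℝ≥0∞)}) ≠ ∞ := fun v => by
    refine ne_top_of_le_ne_top hf (measure_mono fun y hy => ?_)
    rw [Function.mem_support, show f y = v from hy]
    exact (Finset.mem_erase.1 v.2).1
  have hd : Pairwise fun v w : (f.range.erase 0) =>
      Disjoint (f ⁻¹' {(v : ℝ≥0∞)}) (f ⁻¹' {(w : ℝ≥0∞)}) := fun v w hvw =>
    Disjoint.preimage _ (disjoint_singleton.2 fun e => hvw (Subtype.ext e))
  have h1 : ∀ ω, ∑' k, f (Y k ω) = ∑ v : (f.range.erase 0),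
      (v : ℝ≥0∞) * ((pointCount Y (f ⁻¹' {(v : ℝ≥0∞)}) ω : ℕ∞) : ℝ≥0∞) := fun ω => by
    simp_rw [pointCount_eq_tsum, ← ENNReal.tsum_mul_left]
    rw [← Summable.tsum_finsetSum fun _ _ => ENNReal.summable]
    exact tsum_congr fun k => sum_indicator_fiber f id rfl _
  simp_rw [h1]
  rw [h.lintegral_sum_pointCount hB hB' hd fun v => (v : ℝ≥0∞)]
  congr 2
  simp_rw [sum_indicator_fiber f (fun x => 1 - ennrealExpNeg x) (by simp)]
  rw [lintegral_finsetSum _ fun v _ => (measurable_const.indicator (hB v)).const_mul _]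
  refine Finset.sum_congr rfl fun v _ => ?_
  rw [lintegral_const_mul _ (measurable_const.indicator (hB v)), lintegral_indicator (hB v)]
  simp [mul_comm]

/-- The Laplace functional of a homogeneous Poisson process. -/
lemma IsPoissonProcess.laplace_functional [IsProbabilityMeasure μ] (h : IsPoissonProcess μ lam Y)
    {f : Plane → ℝ≥0∞} (hf : Measurable f) :
    ∫⁻ ω, ennrealExpNeg (∑' k, f (Y k ω)) ∂μ =
      ennrealExpNeg (ENNReal.ofReal lam * ∫⁻ y, (1 - ennrealExpNeg (f y))) := by
  -- Restricting to growing balls gives each approximation a support of finite area and keeps the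
  -- sequence increasing to `f`.
  let F : ℕ → SimpleFunc Plane ℝ≥0∞ := fun n =>
    (SimpleFunc.eapprox f n).restrict (Metric.ball 0 n)
  have hF : ∀ n y, F n y = (Metric.ball (0 : Plane) n).indicator (SimpleFunc.eapprox f n) y :=
    fun n y => by rw [SimpleFunc.restrict_apply _ measurableSet_ball]
  have hmono : ∀ y, Monotone fun n => F n y := fun y m n hmn => by
    simp only [hF]
    refine (indicator_le_indicator_of_subset (Metric.ball_subset_ball (by exact_mod_cast hmn))
      (fun _ => zero_le) y).trans (indicator_le_indicator (SimpleFunc.monotone_eapprox f hmn y))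
  have hlim : ∀ y, Tendsto (fun n => F n y) atTop (𝓝 (f y)) := fun y => by
    refine (SimpleFunc.tendsto_eapprox hf y).congr' ?_
    filter_upwards [(tendsto_natCast_atTop_atTop (R := ℝ)).eventually_gt_atTop ‖y‖] with n hn
    rw [hF, indicator_of_mem (by simpa using hn)]
  have hsupp : ∀ n, volume (Function.support (F n)) ≠ ∞ := fun n => by
    refine ne_top_of_le_ne_top (measure_ball_lt_top (x := (0 : Plane)) (r := n)).ne
      (measure_mono fun y hy => ?_)
    by_contra hy'
    exact hy (by rw [hF, indicator_of_notMem hy'])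
  have hsum : ∀ ω, Tendsto (fun n => ∑' k, F n (Y k ω)) atTop (𝓝 (∑' k, f (Y k ω))) := fun ω => by
    simp_rw [← lintegral_count]
    exact lintegral_tendsto_of_tendsto_of_monotone (fun n => .of_discrete)
      (Eventually.of_forall fun k => hmono _) (Eventually.of_forall fun k => hlim _)
  have h1 : Tendsto (fun n => ∫⁻ ω, ennrealExpNeg (∑' k, F n (Y k ω)) ∂μ) atTop
      (𝓝 (∫⁻ ω, ennrealExpNeg (∑' k, f (Y k ω)) ∂μ)) := by
    refine tendsto_lintegral_of_dominated_convergence (fun _ => 1) (fun n => ?_)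
      (fun n => Eventually.of_forall fun ω => ennrealExpNeg.le_one _) (by simp)
      (Eventually.of_forall fun ω => (ennrealExpNeg.continuous.tendsto _).comp (hsum ω))
    exact ennrealExpNeg.measurable.comp
      (Measurable.tsum fun k => (F n).measurable.comp (h.measurable k))
  have h2 : Tendsto (fun n => ∫⁻ y, (1 - ennrealExpNeg (F n y))) atTop
      (𝓝 (∫⁻ y, (1 - ennrealExpNeg (f y)))) := by
    refine lintegral_tendsto_of_tendsto_of_monotone (fun n => ?_)
      (Eventually.of_forall fun y m n hmn =>
        tsub_le_tsub_left (ennrealExpNeg.antitone (hmono y hmn)) _)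
      (Eventually.of_forall fun y => ?_)
    · exact (measurable_const.sub (ennrealExpNeg.measurable.comp (F n).measurable)).aemeasurable
    · exact ENNReal.Tendsto.sub tendsto_const_nhds
        ((ennrealExpNeg.continuous.tendsto _).comp (hlim y)) (Or.inl ENNReal.one_ne_top)
  have h3 := (ennrealExpNeg.continuous.tendsto _).comp
    (ENNReal.Tendsto.const_mul (a := ENNReal.ofReal lam) h2 (Or.inr ENNReal.ofReal_ne_top))
  exact tendsto_nhds_unique h1
    (h3.congr fun n => (h.laplace_functional_simpleFunc (F n) (hsupp n)).symm)

end PoissonProcess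

/-! ### The Laplace transform of the interference -/

lemma ennrealNegLog_one : ennrealNegLog 1 = 0 := by simp [ennrealNegLog]

/-- Fubini for the joint law, which is a product by independence. Using an independent copy over the
same `μ` replaces conditional expectations. -/
lemma ProbabilityTheory.IndepFun.lintegral_eq_lintegral_lintegral {Ω E F : Type*}
    [MeasurableSpace Ω] [MeasurableSpace E] [MeasurableSpace F] {μ : Measure Ω}
    [IsProbabilityMeasure μ] {A : Ω → E} {B : Ω → F} (h : IndepFun A B μ) (hA : Measurable A)
    (hB : Measurable B) {f : E × F → ℝ≥0∞} (hf : Measurable f) :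
    ∫⁻ ω, f (A ω, B ω) ∂μ = ∫⁻ ω, ∫⁻ ω', f (A ω, B ω') ∂μ ∂μ := by
  rw [← lintegral_map hf (hA.prodMk hB),
    (indepFun_iff_map_prod_eq_prod_map_map hA.aemeasurable hB.aemeasurable).1 h,
    lintegral_prod _ hf.aemeasurable, lintegral_map hf.lintegral_prod_right' hA]
  exact lintegral_congr fun ω => lintegral_map (hf.comp measurable_prodMk_left) hB

/-- A version of `lintegral_ennrealExpNeg_tsum` for identically distributed variables, where only
the indices in `{i | c i}` contribute. -/
lemma lintegral_ennrealExpNeg_tsum_ite {Ω ι E : Type*} [Countable ι] [MeasurableSpace Ω]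
    [MeasurableSpace E] {μ : Measure Ω} [IsProbabilityMeasure μ] {κ : Measure E} {Z : ι → Ω → E}
    (hZ : iIndepFun Z μ) (hZm : ∀ i, Measurable (Z i)) (hκ : ∀ i, μ.map (Z i) = κ)
    (c : ι → Prop) [DecidablePred c] {f : ι → E → ℝ≥0∞} (hf : ∀ i, Measurable (f i)) :
    ∫⁻ ω, ennrealExpNeg (∑' i, if c i then f i (Z i ω) else 0) ∂μ =
      ennrealExpNeg (∑' i, if c i then ennrealNegLog (∫⁻ z, ennrealExpNeg (f i z) ∂κ) else 0) := by
  have hm : ∀ i, Measurable fun z => if c i then f i z else 0 := fun i => by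
    by_cases hi : c i <;> simp [hi, hf i]
  rw [lintegral_ennrealExpNeg_tsum (f := fun i z => if c i then f i z else 0) hZ hZm hm]
  congr 2
  funext i
  by_cases hi : c i
  · simp only [hi, if_true]
    rw [← hκ i]
    exact congrArg _ (lintegral_map (ennrealExpNeg.measurable.comp (hf i)) (hZm i)).symm
  · simp [hi, ennrealNegLog_one]

/-- The Laplace transform at `s` of the power received at the origin from a node at `z`. -/
def nodeFactor (s P η α : ℝ) (z : Plane) : ℝ≥0∞ :=
  ∫⁻ h, ennrealExpNeg (ENNReal.ofReal s * (ENNReal.ofReal (P * h * η) * ‖z‖ₑ ^ (-α))) ∂expMeasure 1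

/-- The mean of `nodeFactor` over the positions of a node of the cluster of `y`. -/
def clusterNodeFactor (s P η α a : ℝ) (y : Plane) : ℝ≥0∞ :=
  ∫⁻ x, nodeFactor s P η α (y + x) ∂(cond volume (Metric.closedBall (0 : Plane) a))

lemma measurable_nodePower (s P η α : ℝ) : Measurable fun q : Plane × ℝ =>
    ENNReal.ofReal s * (ENNReal.ofReal (P * q.2 * η) * ‖q.1‖ₑ ^ (-α)) := by
  fun_prop

lemma measurable_nodeFactor (s P η α : ℝ) : Measurable (nodeFactor s P η α) := by
  have := isProbabilityMeasure_expMeasure one_pos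
  exact (ennrealExpNeg.measurable.comp (measurable_nodePower s P η α)).lintegral_prod_right'

lemma measurable_clusterNodeFactor (s P η α a : ℝ) :
    Measurable (clusterNodeFactor s P η α a) :=
  ((measurable_nodeFactor s P η α).comp (measurable_fst.add measurable_snd)).lintegral_prod_right'

lemma nodeFactor_le_one (s P η α : ℝ) (z : Plane) : nodeFactor s P η α z ≤ 1 := by
  have := isProbabilityMeasure_expMeasure one_pos
  exact (lintegral_mono fun h => ennrealExpNeg.le_one _).trans (by simp)

lemma isProbabilityMeasure_cond_closedBall {a : ℝ} (ha : 0 < a) :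
    IsProbabilityMeasure (cond volume (Metric.closedBall (0 : Plane) a)) :=
  cond_isProbabilityMeasure_of_finite (Metric.measure_closedBall_pos _ _ ha).ne'
    measure_closedBall_lt_top.ne

lemma clusterNodeFactor_le_one (s P η α : ℝ) {a : ℝ} (ha : 0 < a) (y : Plane) :
    clusterNodeFactor s P η α a y ≤ 1 := by
  have := isProbabilityMeasure_cond_closedBall ha
  exact (lintegral_mono fun x => nodeFactor_le_one _ _ _ _ _).trans (by simp)

lemma sum_range_eq_tsum_ite (n : ℕ) (f : ℕ → ℝ≥0∞) :
    ∑ i ∈ Finset.range n, f i = ∑' i, if i < n then f i else 0 := by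
  rw [tsum_eq_sum (s := Finset.range n) fun i hi => by simp_all]
  exact Finset.sum_congr rfl fun i hi => by simp_all

lemma tsum_sum_range_eq_tsum_ite (n : ℕ → ℕ) (f : ℕ → ℕ → ℝ≥0∞) :
    ∑' k, ∑ i ∈ Finset.range (n k), f k i =
      ∑' p : ℕ × ℕ, if p.2 < n p.1 then f p.1 p.2 else 0 := by
  simp_rw [sum_range_eq_tsum_ite]
  exact ENNReal.tsum_prod.symm

/-- The Laplace transform of the interference, from the Laplace functional of the Poisson process
of receivers and the independence of the clusters. -/
lemma IsMaternNetwork.laplaceTransform_eq {Ω : Type*} [MeasurableSpace Ω] {μ : Measure Ω}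
    [IsProbabilityMeasure μ] {lam a : ℝ} {ν : Measure ℕ} {Y : ℕ → Ω → Plane} {N : ℕ → Ω → ℕ}
    {X : ℕ → ℕ → Ω → Plane} {H : ℕ → ℕ → Ω → ℝ} (h : IsMaternNetwork μ lam a ν Y N X H)
    (ha : 0 < a) (s P η α : ℝ) :
    laplaceTransform μ (interClusterInterference P η α Y N X H) s =
      (ennrealExpNeg (ENNReal.ofReal lam *
        ∫⁻ y, (1 - ∫⁻ m, clusterNodeFactor s P η α a y ^ m ∂ν))).toReal := by
  have hYm := h.poisson.measurable
  have hNm := h.measurable_size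
  have hXm : ∀ p : ℕ × ℕ, Measurable (X p.1 p.2) := fun p => h.measurable_node _ _
  have hHm : ∀ p : ℕ × ℕ, Measurable (H p.1 p.2) := fun p => h.measurable_fading _ _
  have hY : Measurable fun ω k => Y k ω := measurable_pi_lambda _ hYm
  have hN : Measurable fun ω k => N k ω := measurable_pi_lambda _ hNm
  have hX : Measurable fun ω (p : ℕ × ℕ) => X p.1 p.2 ω := measurable_pi_lambda _ hXm
  have hH : Measurable fun ω (p : ℕ × ℕ) => H p.1 p.2 ω := measurable_pi_lambda _ hHm
  let w : Plane → ℝ → ℝ≥0∞ := fun z t =>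
    ENNReal.ofReal s * (ENNReal.ofReal (P * t * η) * ‖z‖ₑ ^ (-α))
  have hw : Measurable fun q : Plane × ℝ => w q.1 q.2 := measurable_nodePower s P η α
  let F : (ℕ → Plane) × (ℕ → ℕ) × (ℕ × ℕ → Plane) × (ℕ × ℕ → ℝ) → ℝ≥0∞ := fun q =>
    ennrealExpNeg (∑' p : ℕ × ℕ,
      if p.2 < q.2.1 p.1 then w (q.1 p.1 + q.2.2.1 p) (q.2.2.2 p) else 0)
  have hF : Measurable F := by
    refine ennrealExpNeg.measurable.comp (Measurable.tsum fun p => Measurable.ite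
      (measurableSet_lt measurable_const (by fun_prop)) ?_ measurable_const)
    exact hw.comp (Measurable.prodMk (by fun_prop) (by fun_prop))
  have hI : Measurable (interClusterInterference P η α Y N X H) := by
    have : interClusterInterference P η α Y N X H = fun ω => ∑' p : ℕ × ℕ,
        if p.2 < N p.1 ω then
          ENNReal.ofReal (P * H p.1 p.2 ω * η) * ‖Y p.1 ω + X p.1 p.2 ω‖ₑ ^ (-α) else 0 := by
      funext ω
      exact tsum_sum_range_eq_tsum_ite _ _
    rw [this]
    refine Measurable.tsum fun p => Measurable.ite
      (measurableSet_lt measurable_const (hNm _)) ?_ measurable_const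
    have h1 := hYm p.1
    have h2 := hXm p
    have h3 := hHm p
    fun_prop
  have hIF : ∀ ω, ennrealExpNeg (ENNReal.ofReal s * interClusterInterference P η α Y N X H ω) =
      F (fun k => Y k ω, fun k => N k ω, fun p => X p.1 p.2 ω, fun p => H p.1 p.2 ω) := fun ω => by
    simp only [F]
    rw [← tsum_sum_range_eq_tsum_ite (fun k => N k ω) fun k i => w (Y k ω + X k i ω) (H k i ω),
      interClusterInterference, ← ENNReal.tsum_mul_left]
    simp_rw [Finset.mul_sum]
    rfl
  -- Integrating out the fading leaves `ennrealExpNeg` of a series again, so the same factorisation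
  -- applies next to the node positions (`hnode`) and then to the sizes (`hsize`).
  have hfade : ∀ (y : ℕ → Plane) (n : ℕ → ℕ) (x : ℕ × ℕ → Plane),
      ∫⁻ ω, F (y, n, x, fun p => H p.1 p.2 ω) ∂μ = ennrealExpNeg (∑' p : ℕ × ℕ,
        if p.2 < n p.1 then ennrealNegLog (nodeFactor s P η α (y p.1 + x p)) else 0) :=
    fun y n x => lintegral_ennrealExpNeg_tsum_ite h.indep_fading hHm
      (fun p => h.law_fading _ _) (fun p => p.2 < n p.1) (f := fun p t => w (y p.1 + x p) t)
      (fun p => hw.comp measurable_prodMk_left)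
  have hnode : ∀ (y : ℕ → Plane) (n : ℕ → ℕ),
      ∫⁻ ω, ennrealExpNeg (∑' p : ℕ × ℕ, if p.2 < n p.1 then
        ennrealNegLog (nodeFactor s P η α (y p.1 + X p.1 p.2 ω)) else 0) ∂μ =
      ennrealExpNeg (∑' k, n k * ennrealNegLog (clusterNodeFactor s P η α a (y k))) :=
    fun y n => by
    rw [lintegral_ennrealExpNeg_tsum_ite h.indep_node hXm (fun p => h.law_node _ _)
      (fun p => p.2 < n p.1) (f := fun p x => ennrealNegLog (nodeFactor s P η α (y p.1 + x)))
      (fun p => measurable_ennrealNegLog.comp ((measurable_nodeFactor s P η α).comp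
        (measurable_const.add measurable_id)))]
    simp_rw [ennrealExpNeg.negLog (nodeFactor_le_one _ _ _ _ _)]
    rw [← tsum_sum_range_eq_tsum_ite n
      fun k i => ennrealNegLog (∫⁻ x, nodeFactor s P η α (y k + x) ∂_)]
    simp [clusterNodeFactor]
  have hsize : ∀ y : ℕ → Plane,
      ∫⁻ ω, ennrealExpNeg (∑' k, N k ω * ennrealNegLog (clusterNodeFactor s P η α a (y k))) ∂μ =
      ennrealExpNeg (∑' k, ennrealNegLog (∫⁻ m, clusterNodeFactor s P η α a (y k) ^ m ∂ν)) :=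
    fun y => by
    have := lintegral_ennrealExpNeg_tsum_ite h.indep_size hNm h.law_size (fun _ => True)
      (f := fun k m => (m : ℝ≥0∞) * ennrealNegLog (clusterNodeFactor s P η α a (y k)))
      (fun k => .of_discrete)
    simpa only [if_true, ennrealExpNeg.nat_mul,
      ennrealExpNeg.negLog (clusterNodeFactor_le_one s P η α ha _)] using this
  clear_value F
  have hclusters : ∀ (y : ℕ → Plane) (n : ℕ → ℕ),
      ∫⁻ ω, F (y, n, fun p => X p.1 p.2 ω, fun p => H p.1 p.2 ω) ∂μ =
      ennrealExpNeg (∑' k, n k * ennrealNegLog (clusterNodeFactor s P η α a (y k))) :=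
    fun y n => by
    rw [← hnode y n]
    refine (h.indep_node_fading.lintegral_eq_lintegral_lintegral hX hH
      (f := fun q => F (y, n, q))
      (hF.comp (measurable_prodMk_left.comp measurable_prodMk_left))).trans ?_
    exact lintegral_congr fun ω => hfade y n _
  have hreceivers : ∀ y : ℕ → Plane,
      ∫⁻ ω, F (y, fun k => N k ω, fun p => X p.1 p.2 ω, fun p => H p.1 p.2 ω) ∂μ =
      ennrealExpNeg (∑' k, ennrealNegLog (∫⁻ m, clusterNodeFactor s P η α a (y k) ^ m ∂ν)) :=
    fun y => by
    rw [← hsize y]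
    refine (h.indep_size_rest.lintegral_eq_lintegral_lintegral hN (hX.prodMk hH)
      (f := fun q => F (y, q)) (hF.comp measurable_prodMk_left)).trans ?_
    exact lintegral_congr fun ω => hclusters y _
  rw [laplaceTransform_eq_toReal_lintegral μ hI]
  congr 1
  simp_rw [hIF]
  refine (h.indep_receiver_rest.lintegral_eq_lintegral_lintegral hY
    (hN.prodMk (hX.prodMk hH)) hF).trans ?_
  rw [lintegral_congr fun ω => hreceivers fun k => Y k ω]
  have hν : IsProbabilityMeasure ν := h.law_size 0 ▸
    Measure.isProbabilityMeasure_map (hNm 0).aemeasurable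
  have hgm : Measurable fun y => ∫⁻ m, clusterNodeFactor s P η α a y ^ m ∂ν := by
    refine Measurable.lintegral_prod_right'
      (f := fun q : Plane × ℕ => clusterNodeFactor s P η α a q.1 ^ q.2) ?_
    exact measurable_from_prod_countable_left fun m =>
      (measurable_clusterNodeFactor s P η α a).pow_const m
  have hg1 : ∀ y, ∫⁻ m, clusterNodeFactor s P η α a y ^ m ∂ν ≤ 1 := fun y =>
    (lintegral_mono fun m => pow_le_one₀ zero_le (clusterNodeFactor_le_one s P η α ha y)).trans
      (by simp)
  refine (h.poisson.laplace_functional (measurable_ennrealNegLog.comp hgm)).trans ?_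
  congr 2
  exact lintegral_congr fun y => congrArg (1 - ·) (ennrealExpNeg.negLog (hg1 y))

/-! ### Exponential fading and Beta integrals -/

/-- Tilting the unit exponential density by `exp (-b t)` gives `(1 + b)⁻¹` times the density of rate
`1 + b`. Only `t ≥ 0` matters, since the density vanishes elsewhere. -/
lemma lintegral_ennrealExpNeg_mul_expMeasure {b : ℝ} (hb : 0 ≤ b) {f : ℝ → ℝ≥0∞}
    (hfm : Measurable f) (hf : ∀ t, 0 ≤ t → f t = ENNReal.ofReal (b * t)) :
    ∫⁻ t, ennrealExpNeg (f t) ∂expMeasure 1 = ENNReal.ofReal (1 + b)⁻¹ := by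
  have hpdf : ∀ t, exponentialPDF 1 t * ennrealExpNeg (f t) =
      ENNReal.ofReal (1 + b)⁻¹ * exponentialPDF (1 + b) t := fun t => by
    rcases lt_or_ge t 0 with ht | ht
    · simp [exponentialPDF_of_neg ht]
    · rw [exponentialPDF_of_nonneg ht, exponentialPDF_of_nonneg ht, hf t ht,
        ennrealExpNeg.ofReal (by positivity), ← ENNReal.ofReal_mul (by positivity),
        ← ENNReal.ofReal_mul (by positivity), mul_assoc, ← Real.exp_add]
      congr 1
      rw [← mul_assoc, inv_mul_cancel₀ (by positivity), one_mul]
      ring_nf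
  have hm : ∀ r, Measurable (exponentialPDF r) := fun r =>
    (measurable_exponentialPDFReal r).ennreal_ofReal
  have hexp : expMeasure 1 = volume.withDensity (exponentialPDF 1) := rfl
  rw [hexp]
  refine (lintegral_withDensity_eq_lintegral_mul _ (hm 1)
    (ennrealExpNeg.measurable.comp hfm)).trans ((lintegral_congr hpdf).trans ?_)
  rw [lintegral_const_mul _ (hm _), lintegral_exponentialPDF_eq_one (by positivity), mul_one]

/-- The origin is excluded because, for `α > 0`, `‖0‖ₑ ^ (-α) = ∞` whereas the real power `0 ^ (-α)`
is `0`. -/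
lemma nodeFactor_eq {s P η : ℝ} (hs : 0 ≤ s) (hP : 0 < P) (hη : 0 < η) (α : ℝ) {z : Plane}
    (hz : z ≠ 0) :
    nodeFactor s P η α z = ENNReal.ofReal (1 + s * P * η * ‖z‖ ^ (-α))⁻¹ := by
  have hz' : 0 < ‖z‖ := norm_pos_iff.2 hz
  refine lintegral_ennrealExpNeg_mul_expMeasure (by positivity) (by fun_prop) fun t ht => ?_
  rw [← ofReal_norm, ENNReal.ofReal_rpow_of_pos hz', ← ENNReal.ofReal_mul (by positivity),
    ← ENNReal.ofReal_mul hs]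
  congr 1
  ring

/-- The integrand is at most `t ^ (x - 1)` on `(0, 1]` and at most `t ^ (-y - 1)` beyond `1`. -/
lemma integrableOn_betaFun {x y : ℝ} (hx : 0 < x) (hy : 0 < y) :
    IntegrableOn (fun t : ℝ => t ^ (x - 1) / (1 + t) ^ (x + y)) (Ioi 0) := by
  have hm : Measurable fun t : ℝ => t ^ (x - 1) / (1 + t) ^ (x + y) := by fun_prop
  rw [← Ioc_union_Ioi_eq_Ioi zero_le_one]
  refine IntegrableOn.union ?_ ?_
  · have h : IntegrableOn (fun t : ℝ => t ^ (x - 1)) (Ioc 0 1) :=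
      (intervalIntegrable_iff_integrableOn_Ioc_of_le zero_le_one).1
        (intervalIntegral.intervalIntegrable_rpow' (by linarith))
    refine h.mono' hm.aestronglyMeasurable ?_
    filter_upwards [ae_restrict_mem measurableSet_Ioc] with t ht
    have h0 : 0 < t := ht.1
    rw [Real.norm_of_nonneg (by positivity)]
    exact div_le_self (by positivity) (Real.one_le_rpow (by linarith) (by positivity))
  · have h : IntegrableOn (fun t : ℝ => t ^ (-y - 1)) (Ioi 1) :=
      integrableOn_Ioi_rpow_of_lt (by linarith) one_pos
    refine h.mono' hm.aestronglyMeasurable ?_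
    filter_upwards [ae_restrict_mem measurableSet_Ioi] with t ht
    have h0 : 0 < t := one_pos.trans ht
    rw [Real.norm_of_nonneg (by positivity), show -y - 1 = (x - 1) - (x + y) by ring,
      Real.rpow_sub h0 (x - 1) (x + y)]
    exact div_le_div_of_nonneg_left (by positivity) (by positivity)
      (Real.rpow_le_rpow h0.le (by linarith) (by positivity))

lemma lintegral_rpow_mul_exp_neg_mul_Ioi {a r : ℝ} (ha : 0 < a) (hr : 0 < r) :
    ∫⁻ t in Ioi (0 : ℝ), ENNReal.ofReal (t ^ (a - 1) * Real.exp (-(r * t))) =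
      ENNReal.ofReal ((1 / r) ^ a * Real.Gamma a) := by
  have h := Real.integral_rpow_mul_exp_neg_mul_Ioi ha hr
  have hpos : 0 < (1 / r) ^ a * Real.Gamma a := mul_pos (by positivity) (Real.Gamma_pos_of_pos ha)
  rw [← h]
  refine (ofReal_integral_eq_lintegral_ofReal ?_ ?_).symm
  · exact Integrable.of_integral_ne_zero (h ▸ hpos.ne')
  · filter_upwards [ae_restrict_mem measurableSet_Ioi] with t ht
    have : 0 < t := ht
    positivity

/-- Euler's reflection formula for the Beta function. -/
lemma betaFun_one_sub {δ : ℝ} (h0 : 0 < δ) (h1 : δ < 1) :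
    betaFun (1 - δ) δ = Real.pi / Real.sin (Real.pi * δ) := by
  have hint : ∫⁻ t in Ioi (0 : ℝ), ENNReal.ofReal (t ^ (1 - δ - 1) / (1 + t) ^ (1 - δ + δ)) =
      ENNReal.ofReal (Real.Gamma δ * Real.Gamma (1 - δ)) := by
    -- Write `1 / (1 + t)` as `∫ exp (-(1 + t) x) dx` and exchange the integrals by Tonelli: the
    -- inner one is `x ^ (δ - 1) * exp (-x) * Γ(1 - δ)`, the outer one then gives `Γ(δ)`.
    calc ∫⁻ t in Ioi (0 : ℝ), ENNReal.ofReal (t ^ (1 - δ - 1) / (1 + t) ^ (1 - δ + δ))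
        = ∫⁻ t in Ioi (0 : ℝ), ∫⁻ x in Ioi (0 : ℝ),
            ENNReal.ofReal (t ^ (1 - δ - 1) * Real.exp (-((1 + t) * x))) := by
          refine setLIntegral_congr_fun measurableSet_Ioi fun t ht => ?_
          have ht' : 0 < t := ht
          have h := lintegral_rpow_mul_exp_neg_mul_Ioi one_pos (add_pos one_pos ht')
          simp only [sub_self, Real.rpow_zero, one_mul, Real.rpow_one, Real.Gamma_one,
            mul_one] at h
          simp_rw [ENNReal.ofReal_mul (show 0 ≤ t ^ (1 - δ - 1) by positivity)]
          rw [lintegral_const_mul _ (by fun_prop), h, ← ENNReal.ofReal_mul (by positivity)]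
          simp [div_eq_mul_inv]
      _ = ∫⁻ x in Ioi (0 : ℝ), ∫⁻ t in Ioi (0 : ℝ),
            ENNReal.ofReal (t ^ (1 - δ - 1) * Real.exp (-((1 + t) * x))) := by
          refine lintegral_lintegral_swap (Measurable.aemeasurable ?_)
          fun_prop
      _ = ∫⁻ x in Ioi (0 : ℝ), ENNReal.ofReal (Real.Gamma (1 - δ)) *
            ENNReal.ofReal (x ^ (δ - 1) * Real.exp (-(1 * x))) := by
          refine setLIntegral_congr_fun measurableSet_Ioi fun x hx => ?_
          have hx' : 0 < x := hx
          have h := lintegral_rpow_mul_exp_neg_mul_Ioi (sub_pos.2 h1) hx'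
          have he : ∀ t : ℝ, t ^ (1 - δ - 1) * Real.exp (-((1 + t) * x)) =
              Real.exp (-(1 * x)) * (t ^ (1 - δ - 1) * Real.exp (-(x * t))) := fun t => by
            rw [mul_left_comm, ← Real.exp_add]
            congr 2
            ring
          simp_rw [he, ENNReal.ofReal_mul (Real.exp_nonneg (-(1 * x)))]
          rw [lintegral_const_mul _ (by fun_prop), h, ← ENNReal.ofReal_mul (by positivity),
            ← ENNReal.ofReal_mul (Real.Gamma_pos_of_pos (sub_pos.2 h1)).le]
          congr 1
          rw [one_div, Real.inv_rpow hx'.le, ← Real.rpow_neg hx'.le, neg_sub]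
          ring
      _ = ENNReal.ofReal (Real.Gamma δ * Real.Gamma (1 - δ)) := by
          rw [lintegral_const_mul _ (by fun_prop), lintegral_rpow_mul_exp_neg_mul_Ioi h0 one_pos,
            ← ENNReal.ofReal_mul (Real.Gamma_pos_of_pos (sub_pos.2 h1)).le]
          congr 1
          simp [mul_comm]
  rw [betaFun, integral_eq_lintegral_of_nonneg_ae _ (Measurable.aestronglyMeasurable (by fun_prop)), hint,
    ENNReal.toReal_ofReal, Real.Gamma_mul_Gamma_one_sub]
  · exact (mul_pos (Real.Gamma_pos_of_pos h0) (Real.Gamma_pos_of_pos (sub_pos.2 h1))).le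
  · filter_upwards [ae_restrict_mem measurableSet_Ioi] with t ht
    have : 0 < t := ht
    positivity

/-! ### The path-loss integral over the plane -/

/-- Polar coordinates in the plane, followed by the substitution `t = c * r ^ (-α)`. -/
lemma lintegral_plane_comp_rpow_norm {α δ c : ℝ} (hα : 0 < α) (hδ : δ = 2 / α) (hc : 0 < c)
    {K : ℝ → ℝ} (hK : ∀ t, 0 ≤ t → 0 ≤ K t)
    (hint : IntegrableOn (fun t => t ^ (-δ - 1) * K t) (Ioi 0)) :
    ∫⁻ z : Plane, ENNReal.ofReal (K (c * ‖z‖ ^ (-α))) =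
      ENNReal.ofReal (Real.pi * c ^ δ * δ * ∫ t in Ioi (0 : ℝ), t ^ (-δ - 1) * K t) := by
  let f : ℝ → ℝ := fun t => t ^ (-δ - 1) * K t
  -- The constant cancels the Jacobian factor `α` and the power of `c` below: since `α * δ = 2`, `(c
  -- * x ^ (-α)) ^ (-δ - 1) = c ^ (-δ - 1) * x ^ (2 + α)`, and multiplying by `x ^ (-α - 1)` leaves
  -- the planar radial weight `x`.
  let g : ℝ → ℝ := fun t => (α⁻¹ * c ^ (δ + 1)) * f (c * t)
  have hg : IntegrableOn g (Ioi 0) := by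
    refine Integrable.const_mul ?_ _
    have := (integrableOn_Ioi_comp_mul_left_iff f 0 hc).2
    rw [mul_zero] at this
    exact this hint
  have hgi : ∫ t in Ioi (0 : ℝ), g t = α⁻¹ * c ^ δ * ∫ t in Ioi (0 : ℝ), f t := by
    rw [integral_const_mul, integral_comp_mul_left_Ioi f 0 hc, mul_zero, smul_eq_mul,
      Real.rpow_add_one hc.ne']
    field_simp
  have hsubst : ∀ x ∈ Ioi (0 : ℝ), (|(-α)| * x ^ (-α - 1)) • g (x ^ (-α)) =
      x ^ (Module.finrank ℝ Plane - 1) • K (c * x ^ (-α)) := fun x hx => by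
    have hx' : 0 < x := hx
    have hdim : Module.finrank ℝ Plane - 1 = 1 := by simp
    have h1 : (c * x ^ (-α)) ^ (-δ - 1) = (c ^ (δ + 1))⁻¹ * (x ^ (2 + α)) := by
      rw [Real.mul_rpow hc.le (by positivity), ← Real.rpow_mul hx'.le, ← Real.rpow_neg hc.le]
      congr 2
      · ring
      · rw [hδ]
        field_simp
        ring
    have h2 : x ^ (-α - 1) * x ^ (2 + α) = x := by
      rw [← Real.rpow_add hx', show -α - 1 + (2 + α) = 1 by ring, Real.rpow_one]
    have h3 : c ^ (δ + 1) ≠ 0 := (Real.rpow_pos_of_pos hc _).ne'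
    simp only [g, f, smul_eq_mul, h1, hdim, pow_one, abs_neg, abs_of_pos hα]
    calc _ = (α * α⁻¹) * (c ^ (δ + 1) * (c ^ (δ + 1))⁻¹) * (x ^ (-α - 1) * x ^ (2 + α)) *
          K (c * x ^ (-α)) := by ring
      _ = _ := by rw [h2, mul_inv_cancel₀ hα.ne', mul_inv_cancel₀ h3, one_mul, one_mul]
  have hI : Integrable (fun z : Plane => K (c * ‖z‖ ^ (-α))) := by
    rw [integrable_fun_norm_addHaar volume (f := fun r => K (c * r ^ (-α))),
      ← integrableOn_congr_fun hsubst measurableSet_Ioi,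
      integrableOn_Ioi_comp_rpow_iff g (neg_ne_zero.2 hα.ne')]
    exact hg
  rw [← ofReal_integral_eq_lintegral_ofReal hI
    (Eventually.of_forall fun z => hK _ (by positivity))]
  congr 1
  rw [integral_fun_norm_addHaar volume (fun r => K (c * r ^ (-α))),
    ← setIntegral_congr_fun measurableSet_Ioi hsubst,
    integral_comp_rpow_Ioi g (neg_ne_zero.2 hα.ne'), hgi, measureReal_def,
    EuclideanSpace.volume_ball_fin_two]
  simp [f, hδ, Real.pi_pos.le]
  ring

/-- The binomial expansion of `1 - (1 + t)⁻¹ ^ n` in terms of Beta densities. -/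
lemma rpow_mul_one_sub_inv_pow (n : ℕ) (δ : ℝ) {t : ℝ} (ht : 0 < t) :
    t ^ (-δ - 1) * (1 - (1 + t)⁻¹ ^ n) = ∑ p ∈ Finset.Icc 1 n, (n.choose p : ℝ) *
      (t ^ (p - δ - 1) / (1 + t) ^ ((p - δ) + (n - p + δ))) := by
  have h1 : (1 + t) ^ n = 1 + ∑ p ∈ Finset.Icc 1 n, (n.choose p : ℝ) * t ^ p := by
    rw [add_comm, add_pow, Finset.range_eq_Ico, Finset.sum_eq_sum_Ico_succ_bot (by omega)]
    congr 1
    · simp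
    · refine Finset.sum_congr (by ext; simp) fun p _ => ?_
      rw [one_pow, mul_one, mul_comm]
  have h2 : (1 - (1 + t)⁻¹ ^ n) =
      ∑ p ∈ Finset.Icc 1 n, (n.choose p : ℝ) * (t ^ p / (1 + t) ^ n) := by
    simp_rw [← mul_div_assoc]
    rw [← Finset.sum_div, eq_sub_iff_add_eq'.2 h1.symm, sub_div,
      div_self (by positivity), inv_pow, one_div]
  rw [h2, Finset.mul_sum]
  refine Finset.sum_congr rfl fun p _ => ?_
  rw [show (p : ℝ) - δ + (n - p + δ) = n by ring, Real.rpow_natCast,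
    show (p : ℝ) - δ - 1 = (-δ - 1) + p by ring, Real.rpow_add ht, Real.rpow_natCast]
  ring

/-- Subtracting from `1` removes the term `p = 0`, the one not integrable at `0`. For `1 ≤ p ≤ n`
both Beta parameters are positive because `0 < δ < 1`. -/
lemma integrableOn_rpow_mul_one_sub_inv_pow (n : ℕ) {δ : ℝ} (h0 : 0 < δ) (h1 : δ < 1) :
    IntegrableOn (fun t : ℝ => t ^ (-δ - 1) * (1 - (1 + t)⁻¹ ^ n)) (Ioi 0) ∧
    ∫ t in Ioi (0 : ℝ), t ^ (-δ - 1) * (1 - (1 + t)⁻¹ ^ n) =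
      ∑ p ∈ Finset.Icc 1 n, (n.choose p : ℝ) * betaFun (p - δ) (n - p + δ) := by
  have hint : ∀ p ∈ Finset.Icc 1 n, IntegrableOn (fun t : ℝ => (n.choose p : ℝ) *
      (t ^ (p - δ - 1) / (1 + t) ^ ((p - δ) + (n - p + δ)))) (Ioi 0) := fun p hp => by
    have hp' := Finset.mem_Icc.1 hp
    have hp1 : (1 : ℝ) ≤ p := by exact_mod_cast hp'.1
    have hp2 : (p : ℝ) ≤ n := by exact_mod_cast hp'.2
    exact (integrableOn_betaFun (by linarith) (by linarith)).const_mul _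
  have hcongr : EqOn (fun t : ℝ => t ^ (-δ - 1) * (1 - (1 + t)⁻¹ ^ n))
      (fun t => ∑ p ∈ Finset.Icc 1 n, (n.choose p : ℝ) *
        (t ^ (p - δ - 1) / (1 + t) ^ ((p - δ) + (n - p + δ)))) (Ioi 0) :=
    fun t ht => rpow_mul_one_sub_inv_pow n δ ht
  refine ⟨(integrableOn_congr_fun hcongr measurableSet_Ioi).2 (integrable_finsetSum _ hint), ?_⟩
  rw [setIntegral_congr_fun measurableSet_Ioi hcongr, integral_finsetSum _ hint]
  exact Finset.sum_congr rfl fun p _ => integral_const_mul _ _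

lemma lintegral_one_sub_nodeFactor_pow {s P η α δ : ℝ} (hs : 0 < s) (hP : 0 < P) (hη : 0 < η)
    (hα : 2 < α) (hδ : δ = 2 / α) (n : ℕ) :
    ∫⁻ z, (1 - nodeFactor s P η α z ^ n) =
      ENNReal.ofReal (Real.pi * (s * P * η) ^ δ * δ *
        ∑ p ∈ Finset.Icc 1 n, (n.choose p : ℝ) * betaFun (p - δ) (n - p + δ)) := by
  have h0 : 0 < δ := by rw [hδ]; positivity
  have h1 : δ < 1 := by rw [hδ, div_lt_one (by linarith)]; exact hα
  obtain ⟨hint, hval⟩ := integrableOn_rpow_mul_one_sub_inv_pow n h0 h1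
  rw [← hval, ← lintegral_plane_comp_rpow_norm (by linarith) hδ (by positivity)
    (K := fun t => 1 - (1 + t)⁻¹ ^ n) (fun t ht => ?_) hint]
  · refine lintegral_congr_ae ?_
    filter_upwards [Measure.ae_ne volume (0 : Plane)] with z hz
    have hz' : 0 < ‖z‖ := norm_pos_iff.2 hz
    rw [nodeFactor_eq hs.le hP hη α hz, ENNReal.ofReal_sub _ (by positivity),
      ENNReal.ofReal_one, ENNReal.ofReal_pow (by positivity)]
  · exact sub_nonneg.2 (pow_le_one₀ (by positivity) (inv_le_one_of_one_le₀ (by linarith)))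

/-! ### Comparison inequalities -/

/-- After Tonelli, each inner integral over `y` is a translate of `∫ f`, and the law of the
displacement has total mass `1`. -/
lemma lintegral_lintegral_add_cond {a : ℝ} (ha : 0 < a) {f : Plane → ℝ≥0∞} (hf : Measurable f) :
    ∫⁻ y, ∫⁻ x, f (y + x) ∂(cond volume (Metric.closedBall (0 : Plane) a)) = ∫⁻ z, f z := by
  have := isProbabilityMeasure_cond_closedBall ha
  rw [lintegral_lintegral_swap (f := fun y x => f (y + x))
    (hf.comp (measurable_fst.add measurable_snd)).aemeasurable]
  simp_rw [lintegral_add_right_eq_self]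
  simp

lemma one_sub_lintegral {E : Type*} [MeasurableSpace E] {κ : Measure E} [IsProbabilityMeasure κ]
    {f : E → ℝ≥0∞} (hf : Measurable f) (hf1 : ∀ x, f x ≤ 1) :
    ∫⁻ x, (1 - f x) ∂κ = 1 - ∫⁻ x, f x ∂κ := by
  rw [lintegral_sub hf _ (Eventually.of_forall hf1)]
  · simp
  · exact ((lintegral_mono hf1).trans_lt (by simp)).ne

/-- Jensen's inequality for natural powers. -/
lemma pow_lintegral_le_lintegral_pow {E : Type*} [MeasurableSpace E] {κ : Measure E}
    [IsProbabilityMeasure κ] {f : E → ℝ≥0∞} (hf : Measurable f) (n : ℕ) :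
    (∫⁻ x, f x ∂κ) ^ n ≤ ∫⁻ x, f x ^ n ∂κ := by
  rcases Nat.eq_zero_or_pos n with rfl | hn
  · simp
  have h := eLpNorm'_le_eLpNorm'_of_exponent_le (μ := κ) (p := 1) (q := n) one_pos
    (by exact_mod_cast hn) hf.aestronglyMeasurable
  simp only [eLpNorm'_eq_lintegral_enorm, enorm_eq_self, ENNReal.rpow_one, ne_eq, one_ne_zero,
    not_false_eq_true, div_self, ENNReal.rpow_natCast] at h
  refine (pow_le_pow_left₀ zero_le h n).trans_eq ?_
  rw [← ENNReal.rpow_natCast, ← ENNReal.rpow_mul, one_div,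
    inv_mul_cancel₀ (by exact_mod_cast hn.ne'), ENNReal.rpow_one]

lemma one_sub_ennrealExpNeg_le (x : ℝ≥0∞) : 1 - ennrealExpNeg x ≤ x := by
  induction x with
  | top => simp
  | coe x =>
    rw [ennrealExpNeg.coe, ← ENNReal.ofReal_one, ← ENNReal.ofReal_sub _ (Real.exp_nonneg _),
      ← ENNReal.ofReal_coe_nnreal]
    exact ENNReal.ofReal_le_ofReal (by linarith [Real.add_one_le_exp (-(x : ℝ))])

lemma laplaceTransform_zero {Ω : Type*} [MeasurableSpace Ω] (μ : Measure Ω)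
    [IsProbabilityMeasure μ] (I : Ω → ℝ≥0∞) : laplaceTransform μ I 0 = 1 := by
  simp [laplaceTransform, expNeg]

lemma toReal_ennrealExpNeg_ofReal {x : ℝ} (hx : 0 ≤ x) :
    (ennrealExpNeg (ENNReal.ofReal x)).toReal = Real.exp (-x) := by
  rw [ennrealExpNeg.ofReal hx, ENNReal.toReal_ofReal (Real.exp_nonneg _)]

lemma toReal_ennrealExpNeg_antitone : Antitone fun x => (ennrealExpNeg x).toReal :=
  fun _ _ h => ENNReal.toReal_mono (ennrealExpNeg.ne_top _) (ennrealExpNeg.antitone h)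

lemma betaFun_nonneg (x y : ℝ) : 0 ≤ betaFun x y :=
  setIntegral_nonneg measurableSet_Ioi fun t (ht : 0 < t) => by positivity

end

/-! ### The two bounds -/

theorem mainTheorem3 {Ω : Type*} [MeasurableSpace Ω] (μ : Measure Ω) [IsProbabilityMeasure μ]
    (lam a P η α δ s : ℝ) (hlam : 0 < lam) (ha : 0 < a) (hP : 0 < P) (hη : 0 < η)
    (hα : 2 < α) (hδ : δ = 2 / α) (hs : 0 ≤ s)
    (Y : ℕ → Ω → Plane) (N : ℕ → Ω → ℕ) (X : ℕ → ℕ → Ω → Plane) (H : ℕ → ℕ → Ω → ℝ) :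
    (∀ n : ℕ, IsMaternNetwork μ lam a (Measure.dirac n) Y N X H →
      laplaceTransform μ (interClusterInterference P η α Y N X H) s ≤
        Real.exp (-(Real.pi * lam * (s * P * η) ^ δ * δ *
          ∑ p ∈ Finset.Icc 1 n, (n.choose p : ℝ) * betaFun (p - δ) (n - p + δ)))) ∧
    (∀ nbar : ℝ≥0, IsMaternNetwork μ lam a (poissonMeasure nbar) Y N X H →
      Real.exp (-(Real.pi ^ 2 * lam * nbar * (s * P * η) ^ δ * (δ / Real.sin (Real.pi * δ)))) ≤
        laplaceTransform μ (interClusterInterference P η α Y N X H) s) := by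
  have h0 : 0 < δ := by rw [hδ]; positivity
  have h1 : δ < 1 := by rw [hδ, div_lt_one (by linarith)]; exact hα
  rcases hs.eq_or_lt with rfl | hs
  -- At `s = 0` both sides equal `1`, as `0 ^ δ = 0`. The substitution in polar coordinates needs `s
  -- * P * η > 0`, so this case is separate.
  · simp [laplaceTransform_zero, Real.zero_rpow h0.ne']
  have hξ := isProbabilityMeasure_cond_closedBall ha
  have hu := measurable_nodeFactor s P η α
  have hshift : ∀ y : Plane, Measurable fun x => nodeFactor s P η α (y + x) := fun y =>
    hu.comp (measurable_const.add measurable_id)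
  refine ⟨fun n hn => ?_, fun nbar hn => ?_⟩
  · rw [hn.laplaceTransform_eq ha, ← toReal_ennrealExpNeg_ofReal (mul_nonneg (by positivity)
      (Finset.sum_nonneg fun p _ => mul_nonneg (by positivity) (betaFun_nonneg _ _)))]
    refine toReal_ennrealExpNeg_antitone ?_
    have hbound : ∫⁻ z, (1 - nodeFactor s P η α z ^ n) ≤
        ∫⁻ y, (1 - ∫⁻ m, clusterNodeFactor s P η α a y ^ m ∂(Measure.dirac n)) := by
      rw [← lintegral_lintegral_add_cond ha (f := fun z => 1 - nodeFactor s P η α z ^ n)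
        (measurable_const.sub (hu.pow_const n))]
      refine lintegral_mono fun y => ?_
      rw [lintegral_dirac, one_sub_lintegral ((hshift y).pow_const n)
        fun x => pow_le_one₀ zero_le (nodeFactor_le_one _ _ _ _ _)]
      exact tsub_le_tsub_left (pow_lintegral_le_lintegral_pow (hshift y) n) _
    rw [lintegral_one_sub_nodeFactor_pow hs hP hη hα hδ] at hbound
    refine le_trans (le_of_eq ?_) (mul_le_mul_right hbound _)
    rw [← ENNReal.ofReal_mul hlam.le]
    congr 1
    ring
  · have hsin : 0 < Real.sin (Real.pi * δ) :=
      Real.sin_pos_of_pos_of_lt_pi (by positivity) (by nlinarith [Real.pi_pos])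
    rw [hn.laplaceTransform_eq ha, ← toReal_ennrealExpNeg_ofReal (by positivity)]
    refine toReal_ennrealExpNeg_antitone ?_
    -- The power `1` is kept so that the evaluation for `n` nodes applies with `n = 1`; its Beta sum
    -- is then the single term `B(1 - δ, δ)`.
    have hbound : ∫⁻ y, (1 - ∫⁻ m, clusterNodeFactor s P η α a y ^ m ∂(poissonMeasure nbar)) ≤
        nbar * ∫⁻ z, (1 - nodeFactor s P η α z ^ 1) := by
      rw [← lintegral_lintegral_add_cond ha (f := fun z => 1 - nodeFactor s P η α z ^ 1)
        (measurable_const.sub (hu.pow_const 1)),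
        ← lintegral_const_mul' _ _ ENNReal.coe_ne_top]
      refine lintegral_mono fun y => ?_
      simp_rw [pow_one]
      rw [lintegral_pow_poissonMeasure _ (clusterNodeFactor_le_one s P η α ha y),
        one_sub_lintegral (hshift y) fun x => nodeFactor_le_one _ _ _ _ _]
      exact one_sub_ennrealExpNeg_le _
    rw [lintegral_one_sub_nodeFactor_pow hs hP hη hα hδ] at hbound
    refine (mul_le_mul_right hbound _).trans (le_of_eq ?_)
    rw [← ENNReal.ofReal_coe_nnreal, ← ENNReal.ofReal_mul (NNReal.coe_nonneg nbar), ← ENNReal.ofReal_mul hlam.le]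
    congr 1
    simp [betaFun_one_sub h0 h1]
    ring
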